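/- Theorem 3.1. Let $\mathcal{A}$ be an abelian category that has enough projective objects, enough injective objects, and all small limits and colimits. A pair $(\mathcal{X},\mathcal{Y})$ of full subcategories of $\mathcal{A}$ is a cotorsion pair if $\mathcal{X}=\{A \mid \mathrm{Ext}^1_{\mathcal{A}}(A,Y)=0 \text{ for all } Y\in\mathcal{Y}\}$ and $\mathcal{Y}=\{B \mid \mathrm{Ext}^1_{\mathcal{A}}(X,B)=0 \text{ for all } X\in\mathcal{X}\}$. It is complete if every object $M$ fits into short exact sequences $0\to Y\to X\to M\to 0$ and $0\to M\to Y'\to X'\to 0$ with $X,X'\in\mathcal{X}$ and $Y,Y'\in\mathcal{Y}$. It is hereditary if $\mathcal{X}$ contains all projective objects and, for every short exact sequence $0\to X'\to X\to X''\to 0$ with $X''\in\mathcal{X}$, one has $X\in\mathcal{X}$ if and only if $X'\in\mathcal{X}$. Let $(\mathcal{X},\mathcal{Z},\mathcal{Y})$ be a complete and hereditary cotorsion triple in $\mathcal{A}$, i.e. full subcategories such that $(\mathcal{X},\mathcal{Z})$ and $(\mathcal{Z},\mathcal{Y})$ are both complete hereditary cotorsion pairs. Call a (closed Quillen) model structure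 on $\mathcal{A}$ abelian if the (trivial) cofibrations are exactly the monomorphisms with (trivial and) cofibrant cokernel, and the (trivial) fibrations are exactly the epimorphisms with (trivial and) fibrant kernel. Here an object $W$ is trivial if $0\to W$ is a weak equivalence, and a (co)fibration is trivial if it is a weak equivalence. Then there is an abelian model structure on $\mathcal{A}$, the projective model structure, in which the cofibrant objects are exactly the objects of $\mathcal{X}$, every object is fibrant, and the trivial objects are exactly the objects of $\mathcal{Z}$. Dually, there is an abelian model structure on $\mathcal{A}$, the injective model structure, in which every object is cofibrant, the fibrant objects are exactly the objects of $\mathcal{Y}$, and the trivial objects are exactly the objects of $\mathcal{Z}$. -/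

import Mathlib

open CategoryTheory CategoryTheory.Limits HomotopicalAlgebra

universe v u

namespace CotorsionTriples

section Cotorsion

variable {C : Type u} [Category.{v} C] [Abelian C]

/-- The vanishing `Ext¹(A, B) = 0` in an abelian category. (Mathlib's `Ext` needs a universe in
which the Ext-groups live; `max u v` is always possible, and the vanishing does not depend on the
choice.) -/
def ExtOneVanishes (A B : C) : Prop :=
  haveI : HasExt.{max u v} C := HasExt.standard C
  Subsingleton (Abelian.Ext.{max u v} A B 1)

/-- `(X, Y)` is a cotorsion pair: `X = {A | Ext¹(A, B) = 0 for all B ∈ Y}` and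
`Y = {B | Ext¹(A, B) = 0 for all A ∈ X}`. Full subcategories are given by their objects. -/
structure IsCotorsionPair (X Y : ObjectProperty C) : Prop where
  left_iff : ∀ A : C, X A ↔ ∀ B : C, Y B → ExtOneVanishes A B
  right_iff : ∀ B : C, Y B ↔ ∀ A : C, X A → ExtOneVanishes A B

/-- Completeness of the pair `(X, Y)`: every `M` fits into short exact sequences
`0 ⟶ Y₀ ⟶ X₀ ⟶ M ⟶ 0` and `0 ⟶ M ⟶ Y₁ ⟶ X₁ ⟶ 0` with `X₀, X₁ ∈ X` and `Y₀, Y₁ ∈ Y`. -/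
structure IsCompletePair (X Y : ObjectProperty C) : Prop where
  exists_left : ∀ M : C, ∃ (Y₀ X₀ : C) (i : Y₀ ⟶ X₀) (p : X₀ ⟶ M) (w : i ≫ p = 0),
    X X₀ ∧ Y Y₀ ∧ (ShortComplex.mk i p w).ShortExact
  exists_right : ∀ M : C, ∃ (Y₁ X₁ : C) (j : M ⟶ Y₁) (q : Y₁ ⟶ X₁) (w : j ≫ q = 0),
    X X₁ ∧ Y Y₁ ∧ (ShortComplex.mk j q w).ShortExact

/-- A class of objects is resolving if it contains all projective objects and, for every short
exact sequence `0 ⟶ A' ⟶ A ⟶ A'' ⟶ 0` with `A''` in the class, `A` is in the class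
if and only if `A'` is. -/
structure IsResolving (X : ObjectProperty C) : Prop where
  of_projective : ∀ P : C, Projective P → X P
  iff_of_shortExact : ∀ S : ShortComplex C, S.ShortExact → X S.X₃ → (X S.X₂ ↔ X S.X₁)

/-- `(X, Z, Y)` is a cotorsion triple: `(X, Z)` and `(Z, Y)` are cotorsion pairs. -/
structure IsCotorsionTriple (X Z Y : ObjectProperty C) : Prop where
  left : IsCotorsionPair X Z
  right : IsCotorsionPair Z Y

/-- A cotorsion triple is complete if both of its cotorsion pairs are. -/
structure IsCompleteTriple (X Z Y : ObjectProperty C) : Prop where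
  left : IsCompletePair X Z
  right : IsCompletePair Z Y

/-- A cotorsion triple `(X, Z, Y)` is hereditary if both of its cotorsion pairs are, where a
cotorsion pair is called hereditary if its left-hand class is resolving. -/
structure IsHereditaryTriple (X Z Y : ObjectProperty C) : Prop where
  left : IsResolving X
  right : IsResolving Z

end Cotorsion

section Model

variable {C : Type u} [Category.{v} C] [Abelian C] [ModelCategory C]

/-- An object `W` is trivial if `0 ⟶ W` is a weak equivalence. -/
def IsTrivialObject (W : C) : Prop := WeakEquivalence (initial.to W)

variable (C) in
/-- The model structure is compatible with the abelian structure: the (trivial) cofibrations are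
precisely the monomorphisms with (trivial and) cofibrant cokernel, and the (trivial) fibrations are
precisely the epimorphisms with (trivial and) fibrant kernel. -/
structure IsAbelianModelStructure : Prop where
  cofibration_iff : ∀ {A B : C} (f : A ⟶ B),
    Cofibration f ↔ Mono f ∧ IsCofibrant (cokernel f)
  trivialCofibration_iff : ∀ {A B : C} (f : A ⟶ B),
    (Cofibration f ∧ WeakEquivalence f) ↔
      Mono f ∧ IsCofibrant (cokernel f) ∧ IsTrivialObject (cokernel f)
  fibration_iff : ∀ {A B : C} (f : A ⟶ B),
    Fibration f ↔ Epi f ∧ IsFibrant (kernel f)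
  trivialFibration_iff : ∀ {A B : C} (f : A ⟶ B),
    (Fibration f ∧ WeakEquivalence f) ↔
      Epi f ∧ IsFibrant (kernel f) ∧ IsTrivialObject (kernel f)

end Model

end CotorsionTriples

/-! By Hovey's correspondence, an abelian model structure comes from a thick class `Z` and two
complete cotorsion pairs `(P, Q ⊓ Z)` and `(P ⊓ Z, Q)`. The middle class of the triple is thick: it
is closed under extensions as a right-hand class, under kernels of epimorphisms because `Z` is
resolving, and under cokernels of monomorphisms because `X` is. Moreover `X ⊓ Z` consists of the
projectives and `Y ⊓ Z` of the injectives. Hence `(X, Z)` and (projectives, everything) give one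
structure, (everything, injectives) and `(Z, Y)` the other.

Each complete pair yields a weak factorization system (`isWeakFactorizationSystem`): vanishing of
`Ext¹` solves lifting problems and completeness supplies factorizations. Two-out-of-three is
inherited from `Z`: since `Z` contains the injectives, any `f : A ⟶ B` is a monomorphism into some
`B ⊞ I` followed by a projection with kernel in `Z`. The cokernel of that monomorphism, a cone of
`f`, decides whether `f` is a weak equivalence, and the cones of `f`, `f ≫ g`, `g` form a short
exact sequence. -/

namespace CotorsionTriples

open scoped ZeroObject

/-! ### Vanishing of `Ext¹` and lifting problems -/

section ExtOne

variable {C : Type u} [Category.{v} C] [Abelian C]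

lemma extOneVanishes_of_projective (P B : C) [Projective P] : ExtOneVanishes P B := by
  have : HasExt.{max u v} C := HasExt.standard C
  exact Abelian.Ext.subsingleton_of_projective P B 0

lemma extOneVanishes_of_injective (A I : C) [Injective I] : ExtOneVanishes A I := by
  have : HasExt.{max u v} C := HasExt.standard C
  exact Abelian.Ext.subsingleton_of_injective A I 0

lemma ExtOneVanishes.of_retract_left {A A' B : C} (h : ExtOneVanishes A B) (r : Retract A' A) :
    ExtOneVanishes A' B := by
  have : HasExt.{max u v} C := HasExt.standard C
  have h : Subsingleton (Abelian.Ext.{max u v} A B 1) := h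
  refine subsingleton_of_forall_eq (0 : Abelian.Ext.{max u v} A' B 1) fun x => ?_
  rw [← Abelian.Ext.mk₀_id_comp x, ← r.retract, ← Abelian.Ext.mk₀_comp_mk₀_assoc,
    Subsingleton.elim ((Abelian.Ext.mk₀ r.r).comp x (zero_add 1)) 0, Abelian.Ext.comp_zero]

lemma ExtOneVanishes.of_retract_right {A B B' : C} (h : ExtOneVanishes A B) (r : Retract B' B) :
    ExtOneVanishes A B' := by
  have : HasExt.{max u v} C := HasExt.standard C
  have h : Subsingleton (Abelian.Ext.{max u v} A B 1) := h
  refine subsingleton_of_forall_eq (0 : Abelian.Ext.{max u v} A B' 1) fun x => ?_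
  rw [← Abelian.Ext.comp_mk₀_id x, ← r.retract, ← Abelian.Ext.mk₀_comp_mk₀,
    ← Abelian.Ext.comp_assoc_of_second_deg_zero,
    Subsingleton.elim (x.comp (Abelian.Ext.mk₀ r.i) (add_zero 1)) 0, Abelian.Ext.zero_comp]

lemma ExtOneVanishes.right_middle {S : ShortComplex C} (hS : S.ShortExact) {A : C}
    (h₁ : ExtOneVanishes A S.X₁) (h₃ : ExtOneVanishes A S.X₃) : ExtOneVanishes A S.X₂ := by
  have : HasExt.{max u v} C := HasExt.standard C
  have h₁ : Subsingleton (Abelian.Ext.{max u v} A S.X₁ 1) := h₁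
  have h₃ : Subsingleton (Abelian.Ext.{max u v} A S.X₃ 1) := h₃
  refine subsingleton_of_forall_eq (0 : Abelian.Ext.{max u v} A S.X₂ 1) fun x => ?_
  obtain ⟨y, rfl⟩ := Abelian.Ext.covariant_sequence_exact₂ A hS x (Subsingleton.elim _ _)
  rw [Subsingleton.elim y 0, Abelian.Ext.zero_comp]

/-- Dimension shifting: for an epimorphism with kernel `S.X₁`, if `Ext¹(ΩA, S.X₁) = 0` for a syzygy
`ΩA` of `A` and `Ext¹(A, -)` vanishes on the source, then it vanishes on the target. -/
lemma ExtOneVanishes.right_of_syzygy {S T : ShortComplex C} (hS : S.ShortExact)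
    (hT : T.ShortExact) [Projective T.X₂] (h₁ : ExtOneVanishes T.X₁ S.X₁)
    (h₂ : ExtOneVanishes T.X₃ S.X₂) : ExtOneVanishes T.X₃ S.X₃ := by
  have : HasExt.{max u v} C := HasExt.standard C
  have h₁ : Subsingleton (Abelian.Ext.{max u v} T.X₁ S.X₁ 1) := h₁
  have h₂ : Subsingleton (Abelian.Ext.{max u v} T.X₃ S.X₂ 1) := h₂
  have hP : Subsingleton (Abelian.Ext.{max u v} T.X₂ S.X₁ 2) :=
    Abelian.Ext.subsingleton_of_projective _ _ 1
  refine subsingleton_of_forall_eq (0 : Abelian.Ext.{max u v} T.X₃ S.X₃ 1) fun x => ?_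
  -- The obstruction in `Ext²(T.X₃, S.X₁)` dies in `Ext²(T.X₂, S.X₁) = 0`, so it comes from
  -- `Ext¹(T.X₁, S.X₁) = 0`.
  have hx : x.comp hS.extClass (by rfl : 1 + 1 = 2) = 0 := by
    obtain ⟨y, hy⟩ := Abelian.Ext.contravariant_sequence_exact₃ hT S.X₁
      (x.comp hS.extClass (by rfl : 1 + 1 = 2)) (Subsingleton.elim _ _)
      (by rfl : 1 + 1 = 2)
    rw [← hy, Subsingleton.elim y 0, Abelian.Ext.comp_zero]
  obtain ⟨y, rfl⟩ := Abelian.Ext.covariant_sequence_exact₃ T.X₃ hS x (by rfl : 1 + 1 = 2) hx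
  rw [Subsingleton.elim y 0, Abelian.Ext.zero_comp]

lemma ExtOneVanishes.exists_lift {S : ShortComplex C} (hS : S.ShortExact) {A : C}
    (h : ExtOneVanishes A S.X₁) (f : A ⟶ S.X₃) : ∃ g : A ⟶ S.X₂, g ≫ S.g = f := by
  have : HasExt.{max u v} C := HasExt.standard C
  have h : Subsingleton (Abelian.Ext.{max u v} A S.X₁ 1) := h
  obtain ⟨y, hy⟩ := Abelian.Ext.covariant_sequence_exact₃ A hS (Abelian.Ext.mk₀ f)
    (zero_add 1) (Subsingleton.elim _ _)
  obtain ⟨g, rfl⟩ := (Abelian.Ext.mk₀_bijective _ _).2 y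
  rw [Abelian.Ext.mk₀_comp_mk₀] at hy
  exact ⟨g, (Abelian.Ext.mk₀_bijective _ _).1 hy⟩

lemma ExtOneVanishes.exists_extension {S : ShortComplex C} (hS : S.ShortExact) {B : C}
    (h : ExtOneVanishes S.X₃ B) (f : S.X₁ ⟶ B) : ∃ g : S.X₂ ⟶ B, S.f ≫ g = f := by
  have : HasExt.{max u v} C := HasExt.standard C
  have h : Subsingleton (Abelian.Ext.{max u v} S.X₃ B 1) := h
  obtain ⟨y, hy⟩ := Abelian.Ext.contravariant_sequence_exact₁ hS B (Abelian.Ext.mk₀ f)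
    (add_zero 1) (Subsingleton.elim _ _)
  obtain ⟨g, rfl⟩ := (Abelian.Ext.mk₀_bijective _ _).2 y
  rw [Abelian.Ext.mk₀_comp_mk₀] at hy
  exact ⟨g, (Abelian.Ext.mk₀_bijective _ _).1 hy⟩

lemma shortExact_cokernel {A B : C} (f : A ⟶ B) [Mono f] :
    (ShortComplex.mk f (cokernel.π f) (cokernel.condition f)).ShortExact :=
  .mk' (ShortComplex.exact_cokernel f) inferInstance inferInstance

lemma shortExact_kernel {A B : C} (f : A ⟶ B) [Epi f] :
    (ShortComplex.mk (kernel.ι f) f (kernel.condition f)).ShortExact :=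
  .mk' (ShortComplex.exact_kernel f) inferInstance inferInstance

/-- A monomorphism has the left lifting property against an epimorphism if `Ext¹` of the cokernel
by the kernel vanishes. -/
lemma hasLiftingProperty_of_extOneVanishes {A B M N : C} (i : A ⟶ B) (p : M ⟶ N) [Mono i] [Epi p]
    (h : ExtOneVanishes (cokernel i) (kernel p)) : HasLiftingProperty i p where
  sq_hasLift {f g} sq := by
    have hi := shortExact_cokernel i
    have hp := shortExact_kernel p
    have : HasExt.{max u v} C := HasExt.standard C
    have h' : Subsingleton (Abelian.Ext.{max u v} (cokernel i) (kernel p) 1) := h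
    -- The obstruction to lifting `g` through `p` vanishes after restriction along `i`, as `i ≫ g`
    -- lifts to `f`; so it comes from `Ext¹(cokernel i, kernel p) = 0`.
    have hg : (Abelian.Ext.mk₀.{max u v} g).comp hp.extClass (zero_add 1) = 0 := by
      obtain ⟨y, hy⟩ := Abelian.Ext.contravariant_sequence_exact₂ hi (kernel p)
        ((Abelian.Ext.mk₀.{max u v} g).comp hp.extClass (zero_add 1)) (by
          dsimp
          rw [Abelian.Ext.mk₀_comp_mk₀_assoc, ← sq.w, ← Abelian.Ext.mk₀_comp_mk₀_assoc,
            hp.comp_extClass, Abelian.Ext.comp_zero])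
      rw [← hy, Subsingleton.elim y 0, Abelian.Ext.comp_zero]
    obtain ⟨y, hy⟩ := Abelian.Ext.covariant_sequence_exact₃ B hp _ (zero_add 1) hg
    obtain ⟨l, rfl⟩ := (Abelian.Ext.mk₀_bijective _ _).2 y
    rw [Abelian.Ext.mk₀_comp_mk₀] at hy
    have hl : l ≫ p = g := (Abelian.Ext.mk₀_bijective _ _).1 hy
    -- The lift `l` may fail the upper triangle; the error `f - i ≫ l` lands in the kernel of `p`
    -- and extends along `i`, which corrects it.
    obtain ⟨k, hk⟩ := ExtOneVanishes.exists_extension hi h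
      (kernel.lift p (f - i ≫ l) (by simp [hl, sq.w]))
    dsimp at hk
    exact ⟨⟨⟨l + k ≫ kernel.ι p, by simp [reassoc_of% hk], by simp [hl]⟩⟩⟩

end ExtOne

/-! ### Cokernels and kernels of composites -/

section ShortExact

variable {C : Type u} [Category.{v} C] [Abelian C]

lemma shortExact_cokernel_comp {A B D : C} (f : A ⟶ B) (g : B ⟶ D) [Mono g] :
    (ShortComplex.mk (cokernel.map f (f ≫ g) (𝟙 _) g (by simp))
      (cokernel.map (f ≫ g) g f (𝟙 _) (by simp))
      (by ext; simp)).ShortExact := by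
  -- The square is cartesian because `g` is mono, which makes the map of cokernels mono.
  have sq : IsPullback f (𝟙 _) g (f ≫ g) :=
    .of_isLimit' ⟨by simp⟩ (PullbackCone.IsLimit.mk _ (fun s => s.snd)
      (fun s => by simp [← cancel_mono g, s.condition]) (fun s => by simp)
      (fun s m _ hm => by simpa using hm))
  have : Mono (cokernel.map f (f ≫ g) (𝟙 _) g (by simp)) :=
    Abelian.mono_cokernel_map_of_isPullback sq
  have : Epi (cokernel.map (f ≫ g) g f (𝟙 _) (by simp)) :=
    epi_of_epi_fac (f := cokernel.π (f ≫ g)) (h := cokernel.π g) (by simp)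
  refine .mk' (ShortComplex.exact_of_g_is_cokernel _ (CokernelCofork.IsColimit.ofπ' _ _
    fun k hk => ⟨cokernel.desc g (cokernel.π (f ≫ g) ≫ k) ?_, ?_⟩)) ‹_› ‹_›
  · simpa using cokernel.π f ≫= hk
  · ext; simp

lemma shortExact_kernel_comp {A B D : C} (f : A ⟶ B) (g : B ⟶ D) [Epi f] :
    (ShortComplex.mk (kernel.map f (f ≫ g) (𝟙 _) g (by simp))
      (kernel.map (f ≫ g) g f (𝟙 _) (by simp))
      (by ext; simp)).ShortExact := by
  have sq : IsPushout (f ≫ g) f (𝟙 _) g :=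
    .of_isColimit' ⟨by simp⟩ (PushoutCocone.IsColimit.mk _ (fun s => s.inl)
      (fun s => by simp) (fun s => by simp [← cancel_epi f, ← s.condition])
      (fun s m hm _ => by simpa using hm))
  have : Epi (kernel.map (f ≫ g) g f (𝟙 _) (by simp)) :=
    Abelian.epi_kernel_map_of_isPushout sq
  have : Mono (kernel.map f (f ≫ g) (𝟙 _) g (by simp)) :=
    mono_of_mono_fac (h := kernel.ι f) (f := kernel.ι (f ≫ g)) (by simp)
  refine .mk' (ShortComplex.exact_of_f_is_kernel _ (KernelFork.IsLimit.ofι' _ _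
    fun k hk => ⟨kernel.lift f (k ≫ kernel.ι (f ≫ g)) ?_, ?_⟩)) ‹_› ‹_›
  · simpa using hk =≫ kernel.ι g
  · ext; simp

end ShortExact

/-! ### Weak factorization systems from complete cotorsion pairs -/

section FactorizationSystem

variable {C : Type u} [Category.{v} C] [Abelian C]

/-- The monomorphisms with cokernel in `P`. -/
def monoWithCokernel (P : ObjectProperty C) : MorphismProperty C :=
  fun _ _ f => Mono f ∧ P (cokernel f)

/-- The epimorphisms with kernel in `Q`. -/
def epiWithKernel (Q : ObjectProperty C) : MorphismProperty C :=
  fun _ _ f => Epi f ∧ Q (kernel f)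

instance (P : ObjectProperty C) [P.IsStableUnderRetracts] :
    (monoWithCokernel P).IsStableUnderRetracts where
  of_retract {_ _ _ _ f g} r h :=
    ⟨(MorphismProperty.monomorphisms C).of_retract r h.1, P.prop_of_retract
      { i := cokernel.map f g r.i.left r.i.right r.i_w.symm
        r := cokernel.map g f r.r.left r.r.right r.r_w.symm
        retract := by ext; simp } h.2⟩

instance (Q : ObjectProperty C) [Q.IsStableUnderRetracts] :
    (epiWithKernel Q).IsStableUnderRetracts where
  of_retract {_ _ _ _ f g} r h :=
    ⟨(MorphismProperty.epimorphisms C).of_retract r h.1, Q.prop_of_retract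
      { i := kernel.map f g r.i.left r.i.right r.i_w.symm
        r := kernel.map g f r.r.left r.r.right r.r_w.symm
        retract := by ext; simp } h.2⟩

variable {P Q : ObjectProperty C}

namespace IsCotorsionPair

lemma isStableUnderRetracts_left (h : IsCotorsionPair P Q) : P.IsStableUnderRetracts where
  of_retract r hX := (h.left_iff _).2 fun B hB => ((h.left_iff _).1 hX B hB).of_retract_left r

lemma isStableUnderRetracts_right (h : IsCotorsionPair P Q) : Q.IsStableUnderRetracts where
  of_retract r hX := (h.right_iff _).2 fun A hA => ((h.right_iff _).1 hX A hA).of_retract_right r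

lemma right_middle (h : IsCotorsionPair P Q) {S : ShortComplex C} (hS : S.ShortExact)
    (h₁ : Q S.X₁) (h₃ : Q S.X₃) : Q S.X₂ :=
  (h.right_iff _).2 fun A hA => .right_middle hS ((h.right_iff _).1 h₁ A hA)
    ((h.right_iff _).1 h₃ A hA)

lemma extOneVanishes (h : IsCotorsionPair P Q) {A B : C} (hA : P A) (hB : Q B) :
    ExtOneVanishes A B := (h.left_iff A).1 hA B hB

end IsCotorsionPair

lemma epiWithKernel_comp (h : IsCotorsionPair P Q) {A B D : C} {f : A ⟶ B} {g : B ⟶ D}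
    (hf : epiWithKernel Q f) (hg : epiWithKernel Q g) : epiWithKernel Q (f ≫ g) := by
  have := hf.1
  have := hg.1
  exact ⟨inferInstance, h.right_middle (shortExact_kernel_comp f g) hf.2 hg.2⟩

lemma monoWithCokernel_of_shortExact [P.IsClosedUnderIsomorphisms] {A B D : C} {f : A ⟶ B}
    {g : B ⟶ D} {w : f ≫ g = 0} (hS : (ShortComplex.mk f g w).ShortExact) (hD : P D) :
    monoWithCokernel P f :=
  ⟨hS.mono_f, P.prop_of_iso
    ((cokernelIsCokernel f).coconePointUniqueUpToIso hS.gIsCokernel).symm hD⟩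

lemma epiWithKernel_of_shortExact [Q.IsClosedUnderIsomorphisms] {A B D : C} {f : A ⟶ B}
    {g : B ⟶ D} {w : f ≫ g = 0} (hS : (ShortComplex.mk f g w).ShortExact) (hA : Q A) :
    epiWithKernel Q g :=
  ⟨hS.epi_g, Q.prop_of_iso (hS.fIsKernel.conePointUniqueUpToIso (limit.isLimit _)) hA⟩

lemma monoWithCokernel_of_isPushout [P.IsClosedUnderIsomorphisms] {A B D E : C} {t : A ⟶ B}
    {l : A ⟶ D} {r : B ⟶ E} {b : D ⟶ E} (sq : IsPushout t l r b) (h : monoWithCokernel P t) :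
    monoWithCokernel P b :=
  have := isIso_cokernel_map_of_isPushout sq
  ⟨(MorphismProperty.monomorphisms C).of_isPushout sq.flip h.1,
    P.prop_of_iso (asIso (cokernel.map _ _ _ _ sq.w)) h.2⟩

lemma epiWithKernel_of_isPullback [Q.IsClosedUnderIsomorphisms] {A B D E : C} {t : A ⟶ B}
    {l : A ⟶ D} {r : B ⟶ E} {b : D ⟶ E} (sq : IsPullback t l r b) (h : epiWithKernel Q b) :
    epiWithKernel Q t :=
  have := isIso_kernel_map_of_isPullback sq
  ⟨(MorphismProperty.epimorphisms C).of_isPullback sq.flip h.1,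
    Q.prop_of_iso (asIso (kernel.map _ _ _ _ sq.w)).symm h.2⟩

/-- Pushing `A` out along an embedding of `kernel f` into an object of `Q` enlarges the kernel to
that object, while the pushed-out embedding keeps its cokernel in `P`. -/
lemma exists_factorization_of_epi (h : IsCotorsionPair P Q) (hc : IsCompletePair P Q) {A B : C}
    (f : A ⟶ B) [Epi f] : ∃ (E : C) (i : A ⟶ E) (p : E ⟶ B),
      monoWithCokernel P i ∧ epiWithKernel Q p ∧ i ≫ p = f := by
  have := h.isStableUnderRetracts_left
  have := h.isStableUnderRetracts_right
  obtain ⟨Y₁, X₁, j, q, w, hX, hY, hS⟩ := hc.exists_right (kernel f)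
  have hj := monoWithCokernel_of_shortExact hS hX
  obtain ⟨E, r, b, sq⟩ : ∃ (E : C) (r : Y₁ ⟶ E) (b : A ⟶ E), IsPushout j (kernel.ι f) r b :=
    ⟨_, _, _, .of_hasPushout _ _⟩
  obtain ⟨p, hr, hb⟩ := sq.exists_desc 0 f (by simp)
  have : Epi p := epi_of_epi_fac hb
  have : Mono r :=
    (MorphismProperty.monomorphisms C).of_isPushout sq (inferInstanceAs (Mono (kernel.ι f)))
  have hf := shortExact_kernel f
  have hT : (ShortComplex.mk r p hr).ShortExact :=
    .mk' (ShortComplex.exact_of_g_is_cokernel _ (CokernelCofork.IsColimit.ofπ' _ _ fun k hk => by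
      dsimp at k hk
      have hbk : kernel.ι f ≫ b ≫ k = 0 := by rw [← sq.w_assoc, hk, comp_zero]
      have := hf.epi_g
      have hd : f ≫ hf.exact.desc (b ≫ k) hbk = b ≫ k := hf.exact.g_desc _ _
      refine ⟨hf.exact.desc (b ≫ k) hbk, sq.hom_ext ?_ ?_⟩
      · rw [reassoc_of% hr, zero_comp, hk]
      · rw [reassoc_of% hb, hd])) ‹_› ‹_›
  exact ⟨E, b, p, monoWithCokernel_of_isPushout sq hj, epiWithKernel_of_shortExact hT hY, hb⟩

/-- Dual: pull `B` back along an epimorphism from an object of `P` onto `cokernel f`. -/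
lemma exists_factorization_of_mono (h : IsCotorsionPair P Q) (hc : IsCompletePair P Q) {A B : C}
    (f : A ⟶ B) [Mono f] : ∃ (E : C) (i : A ⟶ E) (p : E ⟶ B),
      monoWithCokernel P i ∧ epiWithKernel Q p ∧ i ≫ p = f := by
  have := h.isStableUnderRetracts_left
  have := h.isStableUnderRetracts_right
  obtain ⟨Y₀, X₀, j, q, w, hX, hY, hS⟩ := hc.exists_left (cokernel f)
  have hq := epiWithKernel_of_shortExact hS hY
  obtain ⟨E, t, l, sq⟩ : ∃ (E : C) (t : E ⟶ B) (l : E ⟶ X₀), IsPullback t l (cokernel.π f) q :=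
    ⟨_, _, _, .of_hasPullback _ _⟩
  obtain ⟨i, ht, hl⟩ := sq.exists_lift f 0 (by simp)
  have : Mono i := mono_of_mono_fac ht
  have : Epi l :=
    (MorphismProperty.epimorphisms C).of_isPullback sq (inferInstanceAs (Epi (cokernel.π f)))
  have hf := shortExact_cokernel f
  have hT : (ShortComplex.mk i l hl).ShortExact :=
    .mk' (ShortComplex.exact_of_f_is_kernel _ (KernelFork.IsLimit.ofι' _ _ fun k hk => by
      dsimp at k hk
      have hkt : (k ≫ t) ≫ cokernel.π f = 0 := by
        rw [Category.assoc, sq.w, reassoc_of% hk, zero_comp]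
      have := hf.mono_f
      have hd : hf.exact.lift (k ≫ t) hkt ≫ f = k ≫ t := hf.exact.lift_f _ _
      refine ⟨hf.exact.lift (k ≫ t) hkt, sq.hom_ext ?_ ?_⟩
      · rw [Category.assoc, ht, hd]
      · rw [Category.assoc, hl, comp_zero, hk])) ‹_› ‹_›
  exact ⟨E, i, t, monoWithCokernel_of_shortExact hT hX, epiWithKernel_of_isPullback sq hq, ht⟩

/-- A complete cotorsion pair induces a weak factorization system. -/
lemma isWeakFactorizationSystem (h : IsCotorsionPair P Q) (hc : IsCompletePair P Q) :
    (monoWithCokernel P).IsWeakFactorizationSystem (epiWithKernel Q) := by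
  have := h.isStableUnderRetracts_left
  have := h.isStableUnderRetracts_right
  have : (monoWithCokernel P).HasFactorization (epiWithKernel Q) := ⟨fun {A B} f => by
    -- Adding the summand `B` makes `f` epi. The cokernel of `biprod.inl ≫ i` need not lie in `P`,
    -- so this mono is factored again; closure of `Q` under extensions lets the two epimorphisms
    -- compose.
    have : Epi (biprod.desc f (𝟙 B)) :=
      epi_of_epi_fac (f := biprod.inr) (h := 𝟙 B) (by simp)
    obtain ⟨E, i, p, hi, hp, fac⟩ := exists_factorization_of_epi h hc (biprod.desc f (𝟙 B))
    have := hi.1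
    obtain ⟨E', i', p', hi', hp', fac'⟩ := exists_factorization_of_mono h hc (biprod.inl ≫ i)
    exact ⟨{ Z := E', i := i', p := p' ≫ p, hi := hi', hp := epiWithKernel_comp h hp' hp
             fac := by rw [reassoc_of% fac', fac, biprod.inl_desc] }⟩⟩
  refine .mk' _ _ fun i p hi hp => ?_
  have := hi.1
  have := hp.1
  exact hasLiftingProperty_of_extOneVanishes i p (h.extOneVanishes hi.2 hp.2)

end FactorizationSystem

/-! ### Weak equivalences of a thick class -/

section WeakEquivalences

variable {C : Type u} [Category.{v} C] [Abelian C]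

/-- A class of objects containing the injective objects, and with the two-out-of-three property
for short exact sequences. -/
structure IsThickWithInjectives (Z : ObjectProperty C) : Prop where
  of_injective (I : C) [Injective I] : Z I
  middle {S : ShortComplex C} : S.ShortExact → Z S.X₁ → Z S.X₃ → Z S.X₂
  left {S : ShortComplex C} : S.ShortExact → Z S.X₂ → Z S.X₃ → Z S.X₁
  right {S : ShortComplex C} : S.ShortExact → Z S.X₁ → Z S.X₂ → Z S.X₃

/-- The composites of a monomorphism with cokernel in `Z` and an epimorphism with kernel
in `Z`. -/
def weakEquivalencesOf (Z : ObjectProperty C) : MorphismProperty C := fun A B f =>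
  ∃ (E : C) (i : A ⟶ E) (p : E ⟶ B), monoWithCokernel Z i ∧ epiWithKernel Z p ∧ i ≫ p = f

/-- If `i ≫ p` is a monomorphism and `p` an epimorphism, the kernel of `p` embeds into the cokernel
of `i`, with quotient the cokernel of `i ≫ p`. -/
lemma shortExact_kernel_cokernel_of_mono_comp {A B D : C} (i : A ⟶ B) (p : B ⟶ D) [Mono (i ≫ p)]
    [Epi p] :
    (ShortComplex.mk (kernel.ι p ≫ cokernel.π i) (cokernel.map i (i ≫ p) (𝟙 _) p (by simp))
      (by simp)).ShortExact := by
  have := mono_of_mono i p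
  have hi := shortExact_cokernel i
  have hp := shortExact_kernel p
  refine .mk' (ShortComplex.exact_of_g_is_cokernel _ (CokernelCofork.IsColimit.ofπ' _ _
    fun {T} k hk => ?_)) (Preadditive.mono_of_cancel_zero _ fun {T} x hx => ?_)
    (epi_of_epi_fac (f := cokernel.π i) (h := p ≫ cokernel.π (i ≫ p)) (by simp))
  · dsimp at k hk
    rw [Category.assoc] at hk
    have := hp.epi_g
    obtain ⟨m, hm⟩ : { m : D ⟶ T // p ≫ m = cokernel.π i ≫ k } :=
      ⟨hp.exact.desc _ hk, hp.exact.g_desc _ _⟩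
    exact ⟨cokernel.desc _ m (by simp [hm]), by ext; simp [hm]⟩
  · dsimp at x hx
    have := hi.mono_f
    obtain ⟨y, hy⟩ : { y : T ⟶ A // y ≫ i = x ≫ kernel.ι p } :=
      ⟨hi.exact.lift _ (by simpa using hx), hi.exact.lift_f _ _⟩
    have hy0 : y = 0 := by rw [← cancel_mono (i ≫ p), reassoc_of% hy]; simp
    rw [← cancel_mono (kernel.ι p), ← hy, hy0, zero_comp, zero_comp]

/-- If `i ≫ p` is an epimorphism and `i` a monomorphism, the kernel of `i ≫ p` embeds into the
kernel of `p`, with quotient the cokernel of `i`. -/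
lemma shortExact_kernel_cokernel_of_epi_comp {A B D : C} (i : A ⟶ B) (p : B ⟶ D) [Epi (i ≫ p)]
    [Mono i] :
    (ShortComplex.mk (kernel.map (i ≫ p) p i (𝟙 _) (by simp)) (kernel.ι p ≫ cokernel.π i)
      (by simp)).ShortExact := by
  have := epi_of_epi i p
  have hi := shortExact_cokernel i
  have hp := shortExact_kernel p
  refine .mk' (ShortComplex.exact_of_f_is_kernel _ (KernelFork.IsLimit.ofι' _ _
    fun {T} k hk => ?_)) (mono_of_mono_fac (f := kernel.ι p) (h := kernel.ι (i ≫ p) ≫ i) (by simp))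
    (Preadditive.epi_of_cancel_zero _ fun {T} x hx => ?_)
  · dsimp at k hk
    have := hi.mono_f
    obtain ⟨y, hy⟩ : { y : T ⟶ A // y ≫ i = k ≫ kernel.ι p } :=
      ⟨hi.exact.lift _ (by simpa using hk), hi.exact.lift_f _ _⟩
    exact ⟨kernel.lift _ y (by simp [reassoc_of% hy]), by ext; simp [hy]⟩
  · dsimp at x hx
    rw [Category.assoc] at hx
    have := hp.epi_g
    obtain ⟨m, hm⟩ : { m : D ⟶ T // p ≫ m = cokernel.π i ≫ x } :=
      ⟨hp.exact.desc _ hx, hp.exact.g_desc _ _⟩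
    have hm0 : m = 0 := by rw [← cancel_epi (i ≫ p), Category.assoc, hm]; simp
    rw [← cancel_epi (cokernel.π i), ← hm, hm0, comp_zero, comp_zero]

lemma shortExact_biprod_map_id {B D I : C} (i : B ⟶ D) [Mono i] :
    (ShortComplex.mk (biprod.map i (𝟙 I)) (biprod.fst ≫ cokernel.π i) (by simp)).ShortExact := by
  refine .mk' (ShortComplex.exact_of_g_is_cokernel _ (CokernelCofork.IsColimit.ofπ' _ _
    fun {T} k hk => ?_)) (inferInstanceAs (Mono (biprod.map i (𝟙 I)))) (epi_comp _ _)
  dsimp at k hk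
  have h₁ : i ≫ biprod.inl ≫ k = 0 := by simpa using (biprod.inl : B ⟶ B ⊞ I) ≫= hk
  have h₂ : biprod.inr ≫ k = 0 := by simpa using (biprod.inr : I ⟶ B ⊞ I) ≫= hk
  exact ⟨cokernel.desc _ _ h₁, by ext <;> simp [h₂]⟩

variable {Z : ObjectProperty C}

namespace IsThickWithInjectives

variable (h : IsThickWithInjectives Z)
include h

lemma zero : Z (0 : C) := h.of_injective 0

lemma isClosedUnderIsomorphisms : Z.IsClosedUnderIsomorphisms where
  of_iso {A B} e hA := by
    have w : (0 : (0 : C) ⟶ A) ≫ e.hom = 0 := zero_comp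
    have hS : (ShortComplex.mk _ _ w).ShortExact :=
      .mk' ((ShortComplex.exact_iff_mono _ rfl).2 (inferInstanceAs (Mono e.hom)))
        ⟨fun _ _ _ => (isZero_zero C).eq_of_tgt _ _⟩ (inferInstanceAs (Epi e.hom))
    exact h.right hS h.zero hA

lemma of_isZero {A : C} (hA : IsZero A) : Z A :=
  have := h.isClosedUnderIsomorphisms
  Z.prop_of_iso hA.isoZero.symm h.zero

lemma epiWithKernel_id (A : C) : epiWithKernel Z (𝟙 A) :=
  ⟨inferInstance, h.of_isZero (isZero_kernel_of_mono _)⟩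

lemma epiWithKernel_comp {A B D : C} {f : A ⟶ B} {g : B ⟶ D} (hf : epiWithKernel Z f)
    (hg : epiWithKernel Z g) : epiWithKernel Z (f ≫ g) := by
  have := hf.1
  have := hg.1
  exact ⟨inferInstance, h.middle (shortExact_kernel_comp f g) hf.2 hg.2⟩

lemma epiWithKernel_biprod_fst (A : C) {I : C} (hI : Z I) :
    epiWithKernel Z (biprod.fst : A ⊞ I ⟶ A) :=
  have := h.isClosedUnderIsomorphisms
  epiWithKernel_of_shortExact (f := (biprod.inr : I ⟶ A ⊞ I)) (w := by simp)
    (ShortComplex.Splitting.shortExact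
      { r := biprod.snd
        s := biprod.inl }) hI

lemma cokernel_comp_iff {A B D : C} (i : A ⟶ B) {p : B ⟶ D} (hp : epiWithKernel Z p)
    [Mono (i ≫ p)] : Z (cokernel (i ≫ p)) ↔ Z (cokernel i) := by
  have := hp.1
  have hS := shortExact_kernel_cokernel_of_mono_comp i p
  exact ⟨h.middle hS hp.2, h.right hS hp.2⟩

/-- The criterion is independent of the factorization: two of them are dominated by their pullback
over `B`, whose projections have kernels in `Z` and so do not affect whether cokernels lie in `Z`.
-/
lemma weakEquivalencesOf_iff {A E B : C} (i : A ⟶ E) {p : E ⟶ B} [Mono i]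
    (hp : epiWithKernel Z p) : weakEquivalencesOf Z (i ≫ p) ↔ Z (cokernel i) := by
  have := h.isClosedUnderIsomorphisms
  refine ⟨fun ⟨E', i', p', hi', hp', fac⟩ => ?_, fun hi => ⟨E, i, p, ⟨‹_›, hi⟩, hp, rfl⟩⟩
  obtain ⟨W, t, l, sq⟩ : ∃ (W : C) (t : W ⟶ E') (l : W ⟶ E), IsPullback t l p' p :=
    ⟨_, _, _, .of_hasPullback _ _⟩
  obtain ⟨j, rfl, rfl⟩ := sq.exists_lift i' i fac
  have := hi'.1
  rw [h.cokernel_comp_iff j (epiWithKernel_of_isPullback sq.flip hp'),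
    ← h.cokernel_comp_iff j (epiWithKernel_of_isPullback sq hp)]
  exact hi'.2

lemma weakEquivalencesOf_iff_of_mono {A B : C} (f : A ⟶ B) [Mono f] :
    weakEquivalencesOf Z f ↔ Z (cokernel f) := by
  simpa using h.weakEquivalencesOf_iff f (h.epiWithKernel_id B)

variable [EnoughInjectives C]

lemma exists_mono_lift {A B : C} (f : A ⟶ B) : ∃ (I : C) (j : A ⟶ I), Z I ∧
    Mono (biprod.lift f j) := by
  refine ⟨Injective.under A, Injective.ι A, h.of_injective _, ?_⟩
  exact mono_of_mono_fac (f := biprod.snd) (h := Injective.ι A) (by simp)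

lemma weakEquivalencesOf_iff_of_epi {A B : C} (f : A ⟶ B) [Epi f] :
    weakEquivalencesOf Z f ↔ Z (kernel f) := by
  obtain ⟨I, j, hI, _⟩ := h.exists_mono_lift f
  obtain ⟨i, p, _, hp, rfl⟩ : ∃ (i : A ⟶ B ⊞ I) (p : B ⊞ I ⟶ B), Mono i ∧ epiWithKernel Z p ∧
      i ≫ p = f := ⟨_, _, ‹_›, h.epiWithKernel_biprod_fst B hI, biprod.lift_fst _ _⟩
  rw [h.weakEquivalencesOf_iff i hp]
  have hS := shortExact_kernel_cokernel_of_epi_comp i p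
  exact ⟨h.left hS hp.2, fun hk => h.right hS hk hp.2⟩

/-- Composable morphisms have cones, whose belonging to `Z` detects weak equivalences, which
fit into a short exact sequence. -/
lemma exists_shortExact_cones {A B D : C} (f : A ⟶ B) (g : B ⟶ D) :
    ∃ S : ShortComplex C, S.ShortExact ∧ (weakEquivalencesOf Z f ↔ Z S.X₁) ∧
      (weakEquivalencesOf Z (f ≫ g) ↔ Z S.X₂) ∧ (weakEquivalencesOf Z g ↔ Z S.X₃) := by
  have := h.isClosedUnderIsomorphisms
  obtain ⟨I, j, hI, _⟩ := h.exists_mono_lift f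
  obtain ⟨J, k, hJ, _⟩ := h.exists_mono_lift g
  have hm := shortExact_biprod_map_id (I := I) (biprod.lift g k)
  have hI' := h.epiWithKernel_biprod_fst B hI
  have hJ' := h.epiWithKernel_biprod_fst D hJ
  -- The composite `A ⟶ B ⊞ I ⟶ (D ⊞ J) ⊞ I`, projected to `D`, is `f ≫ g`; the second map fixes
  -- `I`, so its cokernel is the cone of `g`.
  refine ⟨_, shortExact_cokernel_comp (biprod.lift f j) (biprod.map (biprod.lift g k) (𝟙 I)),
    ?_, ?_, ?_⟩
  · rw [← h.weakEquivalencesOf_iff (biprod.lift f j) hI', biprod.lift_fst]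
  · rw [← h.weakEquivalencesOf_iff _
      (h.epiWithKernel_comp (h.epiWithKernel_biprod_fst (D ⊞ J) hI) hJ')]
    simp
  · have e := (cokernelIsCokernel (biprod.map (biprod.lift g k) (𝟙 I))).coconePointUniqueUpToIso
      hm.gIsCokernel
    refine Iff.trans ?_ (Z.prop_iff_of_iso e).symm
    dsimp
    rw [← h.weakEquivalencesOf_iff (biprod.lift g k) hJ', biprod.lift_fst]

lemma hasTwoOutOfThreeProperty : (weakEquivalencesOf Z).HasTwoOutOfThreeProperty where
  comp_mem f g hf hg := by
    obtain ⟨S, hS, h₁, h₂, h₃⟩ := h.exists_shortExact_cones f g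
    exact h₂.2 (h.middle hS (h₁.1 hf) (h₃.1 hg))
  of_postcomp f g hg hfg := by
    obtain ⟨S, hS, h₁, h₂, h₃⟩ := h.exists_shortExact_cones f g
    exact h₁.2 (h.left hS (h₂.1 hfg) (h₃.1 hg))
  of_precomp f g hf hfg := by
    obtain ⟨S, hS, h₁, h₂, h₃⟩ := h.exists_shortExact_cones f g
    exact h₃.2 (h.right hS (h₁.1 hf) (h₂.1 hfg))

end IsThickWithInjectives

end WeakEquivalences

/-! ### Hovey's correspondence -/

section Hovey

variable {C : Type u} [Category.{v} C] [Abelian C]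

lemma mono_and_cokernel_initial_iff {P : ObjectProperty C} [P.IsClosedUnderIsomorphisms] (A : C) :
    (Mono (initial.to A) ∧ P (cokernel (initial.to A))) ↔ P A := by
  have h0 : initial.to A = 0 := initialIsInitial.hom_ext _ _
  have : IsIso (cokernel.π (initial.to A)) := by rw [h0]; infer_instance
  have : Mono (initial.to A) :=
    ⟨fun _ _ _ => (initialIsInitial.isZero).eq_of_tgt _ _⟩
  rw [P.prop_iff_of_iso (asIso (cokernel.π (initial.to A)))]
  exact and_iff_right this

lemma epi_and_kernel_terminal_iff {Q : ObjectProperty C} [Q.IsClosedUnderIsomorphisms] (A : C) :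
    (Epi (terminal.from A) ∧ Q (kernel (terminal.from A))) ↔ Q A := by
  have h0 : terminal.from A = 0 := terminalIsTerminal.hom_ext _ _
  have : IsIso (kernel.ι (terminal.from A)) := by rw [h0]; infer_instance
  have : Epi (terminal.from A) :=
    ⟨fun _ _ _ => (terminalIsTerminal.isZero).eq_of_src _ _⟩
  rw [← Q.prop_iff_of_iso (asIso (kernel.ι (terminal.from A)))]
  exact and_iff_right this

/-- Two complete cotorsion pairs `(P, Q ⊓ Z)` and `(P ⊓ Z, Q)` with `Z` thick determine an abelian
model structure with cofibrant objects `P`, fibrant objects `Q` and trivial objects `Z`. -/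
lemma exists_isAbelianModelStructure [EnoughInjectives C] {P Q Z : ObjectProperty C}
    (hZ : IsThickWithInjectives Z) [P.IsClosedUnderIsomorphisms]
    [Q.IsClosedUnderIsomorphisms]
    (h₁ : IsCotorsionPair P (Q ⊓ Z)) (hc₁ : IsCompletePair P (Q ⊓ Z))
    (h₂ : IsCotorsionPair (P ⊓ Z) Q) (hc₂ : IsCompletePair (P ⊓ Z) Q) :
    ∃ _ : ModelCategory C, IsAbelianModelStructure C ∧ (∀ A : C, IsCofibrant A ↔ P A) ∧
      (∀ A : C, IsFibrant A ↔ Q A) ∧ (∀ A : C, IsTrivialObject A ↔ Z A) := by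
  have := hZ.isClosedUnderIsomorphisms
  let : CategoryWithFibrations C := ⟨epiWithKernel Q⟩
  let : CategoryWithCofibrations C := ⟨monoWithCokernel P⟩
  let : CategoryWithWeakEquivalences C := ⟨weakEquivalencesOf Z⟩
  have cof {A B : C} (f : A ⟶ B) : Cofibration f ↔ Mono f ∧ P (cokernel f) := cofibration_iff f
  have fib {A B : C} (f : A ⟶ B) : Fibration f ↔ Epi f ∧ Q (kernel f) := fibration_iff f
  have weq_mono {A B : C} (f : A ⟶ B) [Mono f] : WeakEquivalence f ↔ Z (cokernel f) :=
    (weakEquivalence_iff f).trans (hZ.weakEquivalencesOf_iff_of_mono f)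
  have weq_epi {A B : C} (f : A ⟶ B) [Epi f] : WeakEquivalence f ↔ Z (kernel f) :=
    (weakEquivalence_iff f).trans (hZ.weakEquivalencesOf_iff_of_epi f)
  have tcof {A B : C} (f : A ⟶ B) : (Cofibration f ∧ WeakEquivalence f) ↔
      Mono f ∧ P (cokernel f) ∧ Z (cokernel f) := by
    rw [cof, and_assoc]
    exact and_congr_right fun _ => by rw [weq_mono]
  have tfib {A B : C} (f : A ⟶ B) : (Fibration f ∧ WeakEquivalence f) ↔
      Epi f ∧ Q (kernel f) ∧ Z (kernel f) := by
    rw [fib, and_assoc]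
    exact and_congr_right fun _ => by rw [weq_epi]
  have htcof : trivialCofibrations C = monoWithCokernel (P ⊓ Z) := by
    ext A B f
    rw [mem_trivialCofibrations_iff, tcof]
    rfl
  have htfib : trivialFibrations C = epiWithKernel (Q ⊓ Z) := by
    ext A B f
    rw [mem_trivialFibrations_iff, tfib]
    rfl
  have : (weakEquivalences C).HasTwoOutOfThreeProperty := hZ.hasTwoOutOfThreeProperty
  have : (cofibrations C).IsWeakFactorizationSystem (trivialFibrations C) := by
    rw [htfib]
    exact isWeakFactorizationSystem h₁ hc₁
  have : (trivialCofibrations C).IsWeakFactorizationSystem (fibrations C) := by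
    rw [htcof]
    exact isWeakFactorizationSystem h₂ hc₂
  have cofibrant (A : C) : IsCofibrant A ↔ P A := (cof _).trans (mono_and_cokernel_initial_iff A)
  have fibrant (A : C) : IsFibrant A ↔ Q A := (fib _).trans (epi_and_kernel_terminal_iff A)
  have trivial_iff (A : C) : WeakEquivalence (initial.to A) ↔ Z A := by
    rw [← mono_and_cokernel_initial_iff (P := Z) A]
    have : Mono (initial.to A) := ⟨fun _ _ _ => (initialIsInitial.isZero).eq_of_tgt _ _⟩
    rw [weq_mono]
    exact (and_iff_right this).symm
  let M : ModelCategory C := ModelCategory.mk' C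
  refine ⟨M, ⟨fun f => ?_, fun f => ?_, fun f => ?_, fun f => ?_⟩,
    cofibrant, fibrant, trivial_iff⟩
  · exact (cof f).trans (by rw [← cofibrant])
  · exact (tcof f).trans (by rw [← cofibrant, ← trivial_iff]; rfl)
  · exact (fib f).trans (by rw [← fibrant])
  · exact (tfib f).trans (by rw [← fibrant, ← trivial_iff]; rfl)

end Hovey

/-! ### Cotorsion triples: thickness and the two intersections -/

section Triples

variable {C : Type u} [Category.{v} C] [Abelian C]

lemma isCotorsionPair_projective_top [EnoughProjectives C] :
    IsCotorsionPair (isProjective C) ⊤ where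
  left_iff A := by
    refine ⟨fun hA B _ => ?_, fun hA => ?_⟩
    · have : Projective A := hA
      exact extOneVanishes_of_projective A B
    · obtain ⟨s, hs⟩ := (hA (kernel (Projective.π A)) trivial).exists_lift
        (shortExact_kernel (Projective.π A)) (𝟙 A)
      exact Retract.projective ⟨s, Projective.π A, hs⟩
  right_iff B := by
    refine ⟨fun _ A hA => ?_, fun _ => trivial⟩
    have : Projective A := hA
    exact extOneVanishes_of_projective A B

lemma isCompletePair_projective_top [EnoughProjectives C] :
    IsCompletePair (isProjective C) ⊤ where
  exists_left M := ⟨_, _, _, _, kernel.condition (Projective.π M), inferInstance, trivial,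
    shortExact_kernel _⟩
  exists_right M := ⟨M, 0, 𝟙 M, 0, comp_zero, inferInstanceAs (Projective (0 : C)), trivial,
    .mk' ((ShortComplex.exact_iff_epi _ rfl).2 (inferInstanceAs (Epi (𝟙 M))))
      (inferInstanceAs (Mono (𝟙 M))) ⟨fun _ _ _ => (isZero_zero C).eq_of_src _ _⟩⟩

lemma isCotorsionPair_top_injective [EnoughInjectives C] :
    IsCotorsionPair ⊤ (isInjective C) where
  left_iff A := by
    refine ⟨fun _ B hB => ?_, fun _ => trivial⟩
    have : Injective B := hB
    exact extOneVanishes_of_injective A B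
  right_iff B := by
    refine ⟨fun hB A _ => ?_, fun hB => ?_⟩
    · have : Injective B := hB
      exact extOneVanishes_of_injective A B
    · obtain ⟨r, hr⟩ := (hB (cokernel (Injective.ι B)) trivial).exists_extension
        (shortExact_cokernel (Injective.ι B)) (𝟙 B)
      exact Retract.injective ⟨Injective.ι B, r, hr⟩

lemma isCompletePair_top_injective [EnoughInjectives C] :
    IsCompletePair ⊤ (isInjective C) where
  exists_left M := ⟨0, M, 0, 𝟙 M, zero_comp, trivial, inferInstanceAs (Injective (0 : C)),
    .mk' ((ShortComplex.exact_iff_mono _ rfl).2 (inferInstanceAs (Mono (𝟙 M))))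
      ⟨fun _ _ _ => (isZero_zero C).eq_of_tgt _ _⟩ (inferInstanceAs (Epi (𝟙 M)))⟩
  exists_right M := ⟨_, _, _, _, cokernel.condition (Injective.ι M), trivial, inferInstance,
    shortExact_cokernel _⟩

/-- In a cotorsion pair with resolving left-hand class, the right-hand class is closed under
cokernels of monomorphisms. -/
lemma IsCotorsionPair.right_of_isResolving [EnoughProjectives C] {X Z : ObjectProperty C}
    (h : IsCotorsionPair X Z) (hX : IsResolving X) {S : ShortComplex C} (hS : S.ShortExact)
    (h₁ : Z S.X₁) (h₂ : Z S.X₂) : Z S.X₃ :=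
  (h.right_iff _).2 fun A hA => by
    have hT := shortExact_kernel (Projective.π A)
    -- The syzygy of `A` stays in `X`, so dimension shifting applies.
    have hK := (hX.iff_of_shortExact _ hT hA).1 (hX.of_projective _ inferInstance)
    exact .right_of_syzygy hS hT (h.extOneVanishes hK h₁) (h.extOneVanishes hA h₂)

variable {X Z Y : ObjectProperty C}

lemma IsCotorsionTriple.isThickWithInjectives [EnoughProjectives C]
    (hT : IsCotorsionTriple X Z Y) (hh : IsHereditaryTriple X Z Y) :
    IsThickWithInjectives Z where
  of_injective I _ := (hT.left.right_iff I).2 fun A _ => extOneVanishes_of_injective A I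
  middle hS h₁ h₃ := hT.left.right_middle hS h₁ h₃
  left hS h₂ h₃ := (hh.right.iff_of_shortExact _ hS h₃).1 h₂
  right hS h₁ h₂ := hT.left.right_of_isResolving hh.left hS h₁ h₂

/-- For `A` in both classes, its syzygy lies in the resolving class `Z`, so `Ext¹` from `A ∈ X` to
it vanishes and the projective presentation splits. -/
lemma IsCotorsionTriple.inf_eq_isProjective [EnoughProjectives C]
    (hT : IsCotorsionTriple X Z Y) (hh : IsHereditaryTriple X Z Y) : X ⊓ Z = isProjective C := by
  ext A
  refine ⟨fun ⟨hX, hZ⟩ => ?_, fun hA => ⟨hh.left.of_projective A hA, hh.right.of_projective A hA⟩⟩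
  have hS := shortExact_kernel (Projective.π A)
  have hK := (hh.right.iff_of_shortExact _ hS hZ).1 (hh.right.of_projective _ inferInstance)
  obtain ⟨s, hs⟩ := (hT.left.extOneVanishes hX hK).exists_lift hS (𝟙 A)
  exact Retract.projective ⟨s, Projective.π A, hs⟩

/-- Dually, thickness puts the cosyzygy in `Z`, and the embedding into an injective splits. -/
lemma IsCotorsionTriple.inf_eq_isInjective [EnoughProjectives C] [EnoughInjectives C]
    (hT : IsCotorsionTriple X Z Y) (hh : IsHereditaryTriple X Z Y) : Y ⊓ Z = isInjective C := by
  have hZ := hT.isThickWithInjectives hh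
  ext A
  refine ⟨fun ⟨hA, hA'⟩ => ?_, fun (hA : Injective A) => ⟨(hT.right.right_iff A).2 fun B _ =>
    extOneVanishes_of_injective B A, hZ.of_injective A⟩⟩
  have hS := shortExact_cokernel (Injective.ι A)
  have hQ := hZ.right hS hA' (hZ.of_injective _)
  obtain ⟨r, hr⟩ := (hT.right.extOneVanishes hQ hA).exists_extension hS (𝟙 A)
  exact Retract.injective ⟨Injective.ι A, r, hr⟩

end Triples

end CotorsionTriples

theorem theorem3p1 {C : Type u} [Category.{v} C] [Abelian C]
    [EnoughProjectives C] [EnoughInjectives C] [HasLimits C] [HasColimits C]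
    (X Z Y : ObjectProperty C)
    (hT : CotorsionTriples.IsCotorsionTriple X Z Y)
    (hc : CotorsionTriples.IsCompleteTriple X Z Y)
    (hh : CotorsionTriples.IsHereditaryTriple X Z Y) :
    (∃ _ : ModelCategory C,
      CotorsionTriples.IsAbelianModelStructure C ∧
      (∀ A : C, IsCofibrant A ↔ X A) ∧
      (∀ A : C, IsFibrant A) ∧
      (∀ A : C, CotorsionTriples.IsTrivialObject A ↔ Z A)) ∧
    (∃ _ : ModelCategory C,
      CotorsionTriples.IsAbelianModelStructure C ∧
      (∀ A : C, IsCofibrant A) ∧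
      (∀ A : C, IsFibrant A ↔ Y A) ∧
      (∀ A : C, CotorsionTriples.IsTrivialObject A ↔ Z A)) := by
  have hZ := hT.isThickWithInjectives hh
  have := hT.left.isStableUnderRetracts_left
  have := hT.right.isStableUnderRetracts_right
  constructor
  · obtain ⟨M, hM, hcof, hfib, htriv⟩ :=
      CotorsionTriples.exists_isAbelianModelStructure (P := X) (Q := ⊤) hZ
      (by rw [top_inf_eq]; exact hT.left) (by rw [top_inf_eq]; exact hc.left)
      (by rw [hT.inf_eq_isProjective hh]; exact CotorsionTriples.isCotorsionPair_projective_top)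
      (by rw [hT.inf_eq_isProjective hh]; exact CotorsionTriples.isCompletePair_projective_top)
    exact ⟨M, hM, hcof, fun A => (hfib A).2 trivial, htriv⟩
  · obtain ⟨M, hM, hcof, hfib, htriv⟩ :=
      CotorsionTriples.exists_isAbelianModelStructure (P := ⊤) (Q := Y) hZ
      (by rw [hT.inf_eq_isInjective hh]; exact CotorsionTriples.isCotorsionPair_top_injective)
      (by rw [hT.inf_eq_isInjective hh]; exact CotorsionTriples.isCompletePair_top_injective)
      (by rw [top_inf_eq]; exact hT.right) (by rw [top_inf_eq]; exact hc.right)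
    exact ⟨M, hM, fun A => (hcof A).2 trivial, hfib, htriv⟩
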